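/- Let $\mathcal H$ be an infinite-dimensional complex Hilbert space, let $\mathcal B(\mathcal H)$ be the bounded linear operators on $\mathcal H$, and let $p,q\ge 1$. For an $m$-tuple ${\bf T}=(T_1,\dots,T_m)$ of bounded linear operators on a complex Hilbert space $\mathcal E$ (here $\mathcal E=\mathcal H$ or a closed subspace of $\mathcal H$) put $$\Lambda_{p,q}({\bf T})=\{(B_1,\dots,B_m)\in {\bf M}_q(\mathbb C)^m:\ X^*T_jX=I_p\otimes B_j\ (1\le j\le m)\text{ for some linear } X:\mathbb C^{p}\otimes\mathbb C^{q}\to\mathcal E\text{ with }X^*X=I\},$$ $$W(q:{\bf T})=\{(X^*T_1X,\dots,X^*T_mX):\ X:\mathbb C^{q}\to\mathcal E\text{ linear with }X^*X=I\},$$ where $pq\times pq$ (respectively $q\times q$) matrices are identified with operators on $\mathbb C^{p}\otimes\mathbb C^{q}$ (respectively $\mathbb C^q$), and let $$\Lambda^{ess}_{p,q}({\bf T})=\bigcap_{{\bf F}}{\bf cl}\,\Lambda_{p,q}({\bf T}+{\bf F}),\qquad W_{ess}(q:{\bf T})=\bigcap_{{\bf F}}{\bf cl}\,W(q:{\bf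 T}+{\bf F}),$$ where ${\bf F}=(F_1,\dots,F_m)$ runs over all $m$-tuples of finite-rank (not necessarily self-adjoint) bounded operators on $\mathcal E$ and ${\bf cl}$ denotes the closure in ${\bf M}_q(\mathbb C)^m$. Let $\mathcal S_{\mathcal F}(\mathcal H)$ be the set of self-adjoint finite-rank operators in $\mathcal B(\mathcal H)$. Let ${\bf A}=(A_1,\dots,A_m)$ be an $m$-tuple of self-adjoint operators in $\mathcal B(\mathcal H)$, let ${\bf F}_0\in\mathcal S_{\mathcal F}(\mathcal H)^m$, and let $Y_0:\mathcal K^\perp\to\mathcal H$ be an isometry ($Y_0^*Y_0=I_{\mathcal K^\perp}$), where $\mathcal K$ is a finite-dimensional subspace of $\mathcal H$ and the range of $Y_0$ has finite codimension in $\mathcal H$. Write $Y_0^*{\bf A}Y_0=(Y_0^*A_1Y_0,\dots,Y_0^*A_mY_0)$, a tuple of operators on $\mathcal K^\perp$. Then $$\Lambda_{p,q}^{ess}({\bf A})=\Lambda_{p,q}^{ess}(Y_0^*{\bf A}Y_0)=\Lambda_{p,q}^{ess}({\bf A}+{\bf F}_0)=\bigcap\{{\bf cl}\,\Lambda_{p,q}({\bf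 A}+{\bf F}):{\bf F}\in\mathcal S_{\mathcal F}(\mathcal H)^m\},$$ and this set is equal to $$W_{ess}(q:{\bf A})=W_{ess}(q:Y_0^*{\bf A}Y_0)=W_{ess}(q:{\bf A}+{\bf F}_0)=\bigcap\{{\bf cl}\,W(q:{\bf A}+{\bf F}):{\bf F}\in\mathcal S_{\mathcal F}(\mathcal H)^m\}.$$ -/

import Mathlib

open scoped Kronecker InnerProductSpace

namespace MatricialRange

/-- The operator `X* T X`. -/
noncomputable def conj {E H : Type*}
    [NormedAddCommGroup E] [InnerProductSpace ℂ E] [CompleteSpace E]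
    [NormedAddCommGroup H] [InnerProductSpace ℂ H] [CompleteSpace H]
    (X : E →L[ℂ] H) (T : H →L[ℂ] H) : E →L[ℂ] E :=
  (ContinuousLinearMap.adjoint X).comp (T.comp X)

/-- `X* X = I`. -/
def IsIsom {E H : Type*}
    [NormedAddCommGroup E] [InnerProductSpace ℂ E] [CompleteSpace E]
    [NormedAddCommGroup H] [InnerProductSpace ℂ H] [CompleteSpace H]
    (X : E →L[ℂ] H) : Prop :=
  (ContinuousLinearMap.adjoint X).comp X = ContinuousLinearMap.id ℂ E

/-- The operator `T` has finite rank. -/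
def FiniteRank {H : Type*} [NormedAddCommGroup H] [InnerProductSpace ℂ H]
    (T : H →L[ℂ] H) : Prop :=
  FiniteDimensional ℂ (LinearMap.range T.toLinearMap)

/-- An isometry `Y : Kᗮ → H` defined on the orthogonal complement of a finite-dimensional subspace
`K` of `H`, whose range has finite codimension in `H`. -/
def IsCofiniteIsom {H : Type*} [NormedAddCommGroup H] [InnerProductSpace ℂ H] [CompleteSpace H]
    (K : Submodule ℂ H) (Y : Kᗮ →L[ℂ] H) : Prop :=
  FiniteDimensional ℂ K ∧ IsIsom Y ∧ FiniteDimensional ℂ (LinearMap.range Y.toLinearMap)ᗮ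

/-- The joint `(p,q)`-matricial range: the tuples `(B₁, …, Bₘ)` of `q × q` matrices such that
`X* Aⱼ X = I_p ⊗ Bⱼ` for all `j`, for one isometry `X` on a `pq`-dimensional space. That space is
identified with `ℂ^(pq)` with its orthonormal basis indexed by pairs. -/
def jointRange {m : ℕ} {H : Type*}
    [NormedAddCommGroup H] [InnerProductSpace ℂ H] [CompleteSpace H]
    (p q : ℕ) (A : Fin m → H →L[ℂ] H) : Set (Fin m → Matrix (Fin q) (Fin q) ℂ) :=
  {B | ∃ X : EuclideanSpace ℂ (Fin p × Fin q) →L[ℂ] H, IsIsom X ∧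
    ∀ j, conj X (A j) =
      Matrix.toEuclideanCLM (𝕜 := ℂ) ((1 : Matrix (Fin p) (Fin p) ℂ) ⊗ₖ B j)}

/-- The joint `q`-matricial range `W(q : A)`: the tuples `(X* A₁ X, …, X* Aₘ X)`, seen as
`q × q` matrices, with `X` an isometry on a `q`-dimensional space (identified with `ℂ^q`). -/
def W {m : ℕ} {H : Type*}
    [NormedAddCommGroup H] [InnerProductSpace ℂ H] [CompleteSpace H]
    (q : ℕ) (A : Fin m → H →L[ℂ] H) : Set (Fin m → Matrix (Fin q) (Fin q) ℂ) :=
  {B | ∃ X : EuclideanSpace ℂ (Fin q) →L[ℂ] H, IsIsom X ∧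
    ∀ j, conj X (A j) = Matrix.toEuclideanCLM (𝕜 := ℂ) (B j)}

/-- The joint essential `(p,q)`-matricial range. The perturbations are arbitrary finite-rank
operators, not only self-adjoint ones. -/
def essRange {m : ℕ} {H : Type*}
    [NormedAddCommGroup H] [InnerProductSpace ℂ H] [CompleteSpace H]
    (p q : ℕ) (A : Fin m → H →L[ℂ] H) : Set (Fin m → Matrix (Fin q) (Fin q) ℂ) :=
  ⋂ F ∈ {F : Fin m → H →L[ℂ] H | ∀ j, FiniteRank (F j)}, closure (jointRange p q (A + F))

/-- The joint essential `q`-matricial range. The perturbations are arbitrary finite-rank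
operators, not only self-adjoint ones. -/
def Wess {m : ℕ} {H : Type*}
    [NormedAddCommGroup H] [InnerProductSpace ℂ H] [CompleteSpace H]
    (q : ℕ) (A : Fin m → H →L[ℂ] H) : Set (Fin m → Matrix (Fin q) (Fin q) ℂ) :=
  ⋂ F ∈ {F : Fin m → H →L[ℂ] H | ∀ j, FiniteRank (F j)}, closure (W q (A + F))

/-- The `m`-tuples of self-adjoint finite-rank operators. -/
def saFiniteRank (m : ℕ) (H : Type*)
    [NormedAddCommGroup H] [InnerProductSpace ℂ H] [CompleteSpace H] :
    Set (Fin m → H →L[ℂ] H) :=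
  {F | ∀ j, IsSelfAdjoint (F j) ∧ FiniteRank (F j)}

end MatricialRange

open scoped Kronecker InnerProductSpace

namespace MatricialRange

/-! ### Orthonormal families, decoupling and Radon weights. -/

section

variable {H : Type*} [NormedAddCommGroup H] [InnerProductSpace ℂ H]

/-! All eight sets equal the set of `B` with `IsEssential A B`: up to any ε, `B` is a compression of
the tuple to a subspace orthogonal to any prescribed finite-dimensional one. Finite-rank
perturbations and compression by `Y₀` do not affect this condition.

An essential `B` lies in every closure, even of the smaller range `jointRange`. By
`IsAmplifiedEssential.double`, exact compressions `I ⊗ B'` with `B'` near `B` can have their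
multiplicity doubled: many mutually decoupled families give matrices near `B`, and Radon's theorem
finds two disjointly supported convex combinations of these with the same value.

Conversely, `isEssential_of_forall_mem_closure_W` needs only self-adjoint perturbations of the
larger range `W`. Perturb `T` to `(1 - P) T (1 - P) + c P`, with `P` the projection onto `V` and `c`
in the joint essential numerical range; the part of a compression living in `V` can then be traded
for vectors outside `V` on which `T` acts nearly like `c`. -/

/-- Isometries on `ℂ^ι` with prescribed compressions are orthonormal families with prescribed
matrix entries. -/
lemma exists_isIsom_iff [CompleteSpace H] {m : ℕ} {ι : Type*} [Fintype ι] [DecidableEq ι]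
    (T : Fin m → H →L[ℂ] H) (M : Fin m → Matrix ι ι ℂ) :
    (∃ X : EuclideanSpace ℂ ι →L[ℂ] H, IsIsom X ∧
      ∀ j, conj X (T j) = Matrix.toEuclideanCLM (𝕜 := ℂ) (M j)) ↔
    ∃ x : ι → H, Orthonormal ℂ x ∧ ∀ j a b, ⟪x a, T j (x b)⟫_ℂ = M j a b := by
  have entry : ∀ (N : Matrix ι ι ℂ) (a b : ι),
      ⟪EuclideanSpace.single a (1 : ℂ),
        Matrix.toEuclideanCLM (𝕜 := ℂ) N (EuclideanSpace.single b (1 : ℂ))⟫_ℂ = N a b := by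
    intro N a b
    rw [EuclideanSpace.inner_single_left]
    simp [Matrix.ofLp_toEuclideanCLM]
  constructor
  · rintro ⟨X, hX, hT⟩
    refine ⟨fun a => X (EuclideanSpace.single a 1), ?_, fun j a b => ?_⟩
    · have := (EuclideanSpace.orthonormal_single (𝕜 := ℂ) (ι := ι)).comp_linearIsometry
        ⟨X.toLinearMap, fun v => ?_⟩
      · exact this
      · have h : ⟪X v, X v⟫_ℂ = ⟪v, v⟫_ℂ := by
          rw [← ContinuousLinearMap.adjoint_inner_right]
          congr 1
          exact DFunLike.congr_fun hX v
        rw [@norm_eq_sqrt_re_inner ℂ, @norm_eq_sqrt_re_inner ℂ]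
        exact congrArg (fun z => Real.sqrt (RCLike.re z)) h
    · refine Eq.trans ?_ (entry (M j) a b)
      rw [← hT, conj]
      simp [ContinuousLinearMap.adjoint_inner_right]
  · rintro ⟨x, hx, hT⟩
    let X : EuclideanSpace ℂ ι →L[ℂ] H :=
      LinearMap.toContinuousLinearMap
        ((EuclideanSpace.basisFun ι ℂ).toBasis.constr ℂ x)
    have hXs : ∀ a, X (EuclideanSpace.single a 1) = x a := by
      intro a
      have h := (EuclideanSpace.basisFun ι ℂ).toBasis.constr_basis ℂ x a
      rw [OrthonormalBasis.coe_toBasis, EuclideanSpace.basisFun_apply] at h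
      exact h
    have ext_entry : ∀ P Q : EuclideanSpace ℂ ι →L[ℂ] EuclideanSpace ℂ ι,
        (∀ a b, ⟪EuclideanSpace.single a (1 : ℂ), P (EuclideanSpace.single b (1 : ℂ))⟫_ℂ =
          ⟪EuclideanSpace.single a (1 : ℂ), Q (EuclideanSpace.single b (1 : ℂ))⟫_ℂ) → P = Q := by
      intro P Q h
      apply ContinuousLinearMap.coe_injective
      refine (EuclideanSpace.basisFun ι ℂ).toBasis.ext fun b => ?_
      refine InnerProductSpace.ext_inner_left_basis (𝕜 := ℂ)
        (EuclideanSpace.basisFun ι ℂ).toBasis fun a => ?_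
      simpa using h a b
    refine ⟨X, ext_entry _ _ fun a b => ?_, fun j => ext_entry _ _ fun a b => ?_⟩
    · rw [ContinuousLinearMap.comp_apply, ContinuousLinearMap.adjoint_inner_right, hXs, hXs]
      rw [orthonormal_iff_ite.1 hx]
      simp [EuclideanSpace.inner_single_left]
    · rw [entry, conj, ContinuousLinearMap.comp_apply, ContinuousLinearMap.adjoint_inner_right,
        ContinuousLinearMap.comp_apply, hXs, hXs, hT]

lemma mem_jointRange_iff [CompleteSpace H] {m p q : ℕ} (T : Fin m → H →L[ℂ] H)
    (B : Fin m → Matrix (Fin q) (Fin q) ℂ) :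
    B ∈ jointRange p q T ↔ ∃ x : Fin p × Fin q → H, Orthonormal ℂ x ∧
      ∀ j a b, ⟪x a, T j (x b)⟫_ℂ = if a.1 = b.1 then B j a.2 b.2 else 0 := by
  refine (exists_isIsom_iff T _).trans ?_
  simp [Matrix.kroneckerMap_apply, Matrix.one_apply]

lemma mem_W_iff [CompleteSpace H] {m q : ℕ} (T : Fin m → H →L[ℂ] H)
    (B : Fin m → Matrix (Fin q) (Fin q) ℂ) :
    B ∈ W q T ↔ ∃ x : Fin q → H, Orthonormal ℂ x ∧
      ∀ j a b, ⟪x a, T j (x b)⟫_ℂ = B j a b :=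
  exists_isIsom_iff T B

/-- Stated for plain functions, which carry the sup metric; the matrix version has the same product
topology and follows by unfolding. -/
lemma mem_closure_pi_iff {m q : ℕ} (S : Set (Fin m → Fin q → Fin q → ℂ))
    (B : Fin m → Fin q → Fin q → ℂ) :
    B ∈ closure S ↔ ∀ ε > 0, ∃ B' ∈ S, ∀ j a b, ‖B' j a b - B j a b‖ < ε := by
  rw [Metric.mem_closure_iff]
  refine forall₂_congr fun ε hε => exists_congr fun B' => and_congr_right fun _ => ?_
  simp_rw [dist_comm B, dist_pi_lt_iff hε, dist_eq_norm]

lemma mem_closure_iff_entries {m q : ℕ} (S : Set (Fin m → Matrix (Fin q) (Fin q) ℂ))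
    (B : Fin m → Matrix (Fin q) (Fin q) ℂ) :
    B ∈ closure S ↔ ∀ ε > 0, ∃ B' ∈ S, ∀ j a b, ‖B' j a b - B j a b‖ < ε :=
  mem_closure_pi_iff S B

lemma jointRange_subset_W [CompleteSpace H] {m p q : ℕ} (hp : 1 ≤ p) (T : Fin m → H →L[ℂ] H) :
    jointRange p q T ⊆ W q T := by
  intro B hB
  obtain ⟨x, hx, hT⟩ := (mem_jointRange_iff T B).1 hB
  refine (mem_W_iff T B).2 ⟨fun a => x (⟨0, hp⟩, a), hx.comp _ fun a b h => ?_, fun j a b => ?_⟩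
  · simpa using h
  · simp [hT]

/-- Finite families with property `P`, available in the orthogonal complement of every
finite-dimensional subspace, can be chosen repeatedly so that the operators `T j` do not couple
different members of the selection. -/
lemma exists_decoupled_families [CompleteSpace H] {m : ℕ} {T : Fin m → H →L[ℂ] H}
    (hT : ∀ j, IsSelfAdjoint (T j)) {α : Type*} [Finite α] {P : (α → H) → Prop}
    (hP : ∀ V : Submodule ℂ H, FiniteDimensional ℂ V → ∃ y : α → H, P y ∧ ∀ a, y a ∈ Vᗮ)
    (N : ℕ) (V : Submodule ℂ H) [FiniteDimensional ℂ V] :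
    ∃ y : Fin N → α → H, (∀ i, P (y i)) ∧ (∀ i a, y i a ∈ Vᗮ) ∧
      ∀ i k, i ≠ k → ∀ a b, ⟪y i a, y k b⟫_ℂ = 0 ∧ ∀ j, ⟪y i a, T j (y k b)⟫_ℂ = 0 := by
  induction N with
  | zero => exact ⟨fun i => i.elim0, fun i => i.elim0, fun i => i.elim0, fun i => i.elim0⟩
  | succ N ih =>
    obtain ⟨y, hy, hyV, hyo⟩ := ih
    let S : Set H := Set.range (fun ia : Fin N × α => y ia.1 ia.2) ∪
      Set.range (fun ia : Fin m × Fin N × α => T ia.1 (y ia.2.1 ia.2.2))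
    have hS : S.Finite := (Set.finite_range _).union (Set.finite_range _)
    have : FiniteDimensional ℂ (Submodule.span ℂ S) := FiniteDimensional.span_of_finite ℂ hS
    obtain ⟨z, hz, hzV⟩ := hP (V ⊔ Submodule.span ℂ S) inferInstance
    have hz1 : ∀ i a b, ⟪y i a, z b⟫_ℂ = 0 := fun i a b =>
      (Submodule.mem_orthogonal _ _).1 (hzV b) _
        (Submodule.mem_sup_right (Submodule.subset_span (Or.inl ⟨(i, a), rfl⟩)))
    have hz2 : ∀ j i a b, ⟪T j (y i a), z b⟫_ℂ = 0 := fun j i a b =>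
      (Submodule.mem_orthogonal _ _).1 (hzV b) _
        (Submodule.mem_sup_right (Submodule.subset_span (Or.inr ⟨(j, i, a), rfl⟩)))
    have hz3 : ∀ j i a b, ⟪y i a, T j (z b)⟫_ℂ = 0 := fun j i a b => by
      rw [← hz2 j i a b, ← ContinuousLinearMap.adjoint_inner_left, (hT j).adjoint_eq]
    refine ⟨Fin.snoc y z, fun i => ?_, fun i => ?_, fun i k => ?_⟩
    · induction i using Fin.lastCases <;> simp [hz, hy]
    · induction i using Fin.lastCases with
      | last =>
        simpa using fun a => Submodule.orthogonal_le le_sup_left (hzV a)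
      | cast i => simpa using hyV i
    · induction i using Fin.lastCases with
      | last =>
        induction k using Fin.lastCases with
        | last => simp
        | cast k =>
          intro _ a b
          simp only [Fin.snoc_last, Fin.snoc_castSucc]
          refine ⟨by rw [inner_eq_zero_symm]; exact hz1 k b a, fun j => ?_⟩
          rw [inner_eq_zero_symm]; exact hz2 j k b a
      | cast i =>
        induction k using Fin.lastCases with
        | last =>
          intro _ a b
          simp only [Fin.snoc_last, Fin.snoc_castSucc]
          exact ⟨hz1 i a b, fun j => hz3 j i a b⟩
        | cast k =>
          intro hik a b
          simp only [Fin.snoc_castSucc]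
          exact hyo i k (fun h => hik (by rw [h])) a b

/-- Finitely many points, more than the dimension plus one, have two convex combinations with
disjoint supports and the same value. -/
lemma exists_radon_weights {E : Type*} [AddCommGroup E] [Module ℝ E] [FiniteDimensional ℝ E]
    {N : ℕ} (hN : Module.finrank ℝ E + 1 < N) (v : Fin N → E) :
    ∃ t : Bool → Fin N → ℝ, (∀ s i, 0 ≤ t s i) ∧ (∀ s, ∑ i, t s i = 1) ∧
      (∀ i, t true i * t false i = 0) ∧ ∑ i, t true i • v i = ∑ i, t false i • v i := by
  let L : (Fin N → ℝ) →ₗ[ℝ] E × ℝ :=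
    (Fintype.linearCombination ℝ v).prod (Fintype.linearCombination ℝ fun _ => (1 : ℝ))
  have hker : LinearMap.ker L ≠ ⊥ := LinearMap.ker_ne_bot_of_finrank_lt (by simpa using hN)
  obtain ⟨g, hg, hg0⟩ := Submodule.exists_mem_ne_zero_of_ne_bot hker
  have hg1 : ∑ i, g i • v i = 0 := by
    simpa [L, Fintype.linearCombination_apply] using congrArg Prod.fst (LinearMap.mem_ker.1 hg)
  have hg2 : ∑ i, g i = 0 := by
    simpa [L, Fintype.linearCombination_apply] using congrArg Prod.snd (LinearMap.mem_ker.1 hg)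
  have hpm : ∀ i, max (g i) 0 = max (-g i) 0 + g i := fun i => by
    rcases le_total (g i) 0 with h | h <;> simp [h]
  have hsum : ∑ i, max (g i) 0 = ∑ i, max (-g i) 0 := by
    simp_rw [hpm]; rw [Finset.sum_add_distrib, hg2, add_zero]
  have hpos : 0 < ∑ i, max (g i) 0 := by
    refine lt_of_le_of_ne (Finset.sum_nonneg fun i _ => le_max_right _ _) fun h => hg0 ?_
    have h1 := (Finset.sum_eq_zero_iff_of_nonneg fun i _ => le_max_right (g i) 0).1 h.symm
    have h2 := (Finset.sum_eq_zero_iff_of_nonneg fun i _ => le_max_right (-g i) 0).1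
      (hsum.symm.trans h.symm)
    funext i
    have := hpm i
    rw [h1 i (Finset.mem_univ _), h2 i (Finset.mem_univ _)] at this
    simpa using this.symm
  set S := ∑ i, max (g i) 0 with hS
  refine ⟨fun s i => S⁻¹ * (if s then max (g i) 0 else max (-g i) 0), fun s i => ?_, fun s => ?_,
    fun i => ?_, ?_⟩
  · refine mul_nonneg (inv_nonneg.2 hpos.le) ?_
    split_ifs <;> exact le_max_right _ _
  · rw [← Finset.mul_sum]
    cases s
    · simp only [Bool.false_eq_true, if_false]
      rw [← hsum, inv_mul_cancel₀ hpos.ne']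
    · simp only [if_true]
      rw [← hS, inv_mul_cancel₀ hpos.ne']
  · rcases le_total (g i) 0 with h | h <;> simp [h]
  · simp only [if_true, Bool.false_eq_true, if_false, mul_smul, ← Finset.smul_sum]
    congr 1
    simp_rw [hpm, add_smul]
    rw [Finset.sum_add_distrib, hg1, add_zero]

end

/-! ### Essential tuples: amplification and invariance. -/

section

variable {H : Type*} [NormedAddCommGroup H] [InnerProductSpace ℂ H]

/-- `B` is approximated by compressions of `T` to `q`-dimensional subspaces orthogonal to any given
finite-dimensional subspace. -/
def IsEssential {m q : ℕ} (T : Fin m → H →L[ℂ] H) (B : Fin m → Matrix (Fin q) (Fin q) ℂ) : Prop :=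
  ∀ V : Submodule ℂ H, FiniteDimensional ℂ V → ∀ ε > 0, ∃ x : Fin q → H, Orthonormal ℂ x ∧
    (∀ a, x a ∈ Vᗮ) ∧ ∀ j a b, ‖⟪x a, T j (x b)⟫_ℂ - B j a b‖ < ε

/-- As `IsEssential`, with compressions exactly of the form `I ⊗ B'`, the identity having size
`ι`. -/
def IsAmplifiedEssential {m q : ℕ} (ι : Type*) [DecidableEq ι] (T : Fin m → H →L[ℂ] H)
    (B : Fin m → Matrix (Fin q) (Fin q) ℂ) : Prop :=
  ∀ V : Submodule ℂ H, FiniteDimensional ℂ V → ∀ ε > 0, ∃ x : ι × Fin q → H, Orthonormal ℂ x ∧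
    (∀ a, x a ∈ Vᗮ) ∧ ∃ B' : Fin m → Fin q → Fin q → ℂ, (∀ j a b, ‖B' j a b - B j a b‖ < ε) ∧
      ∀ j a b, ⟪x a, T j (x b)⟫_ℂ = if a.1 = b.1 then B' j a.2 b.2 else 0

variable {m q : ℕ} {T : Fin m → H →L[ℂ] H} {B : Fin m → Matrix (Fin q) (Fin q) ℂ}

lemma IsEssential.isAmplifiedEssential_unit (h : IsEssential T B) :
    IsAmplifiedEssential Unit T B := by
  intro V hV ε hε
  obtain ⟨x, hx, hxV, hxB⟩ := h V hV ε hε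
  refine ⟨fun a => x a.2, hx.comp _ fun a b hab => Prod.ext rfl hab, fun a => hxV _,
    fun j a b => ⟪x a, T j (x b)⟫_ℂ, hxB, fun j a b => by simp⟩

lemma IsAmplifiedEssential.comap {ι κ : Type*} [DecidableEq ι] [DecidableEq κ] (f : κ ↪ ι)
    (h : IsAmplifiedEssential ι T B) : IsAmplifiedEssential κ T B := by
  intro V hV ε hε
  obtain ⟨x, hx, hxV, B', hB', hxB⟩ := h V hV ε hε
  refine ⟨fun a => x (f a.1, a.2), hx.comp _ fun a b hab => ?_, fun a => hxV _, B', hB',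
    fun j a b => ?_⟩
  · rw [Prod.mk.injEq] at hab
    exact Prod.ext (f.injective hab.1) hab.2
  · simp [hxB]

/-- Matrix entries of weighted sums of mutually decoupled families. -/
lemma inner_sum_smul_of_decoupled {N : ℕ} {α : Type*} (S : H →L[ℂ] H) (y : Fin N → α → H)
    (h : ∀ i k, i ≠ k → ∀ a b, ⟪y i a, S (y k b)⟫_ℂ = 0) (r s : Fin N → ℝ) (a b : α) :
    ⟪∑ i, (r i : ℂ) • y i a, S (∑ i, (s i : ℂ) • y i b)⟫_ℂ =
      ∑ i, ((r i * s i : ℝ) : ℂ) * ⟪y i a, S (y i b)⟫_ℂ := by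
  rw [map_sum, sum_inner]
  refine Finset.sum_congr rfl fun i _ => ?_
  rw [inner_sum, Finset.sum_eq_single i]
  · rw [map_smul, inner_smul_left, inner_smul_right, Complex.conj_ofReal]
    push_cast
    ring
  · intro k _ hk
    rw [map_smul, inner_smul_left, inner_smul_right, h i k hk.symm]
    simp
  · simp

/-- Radon's theorem splits decoupled families into two groups whose weighted averages of
compressions agree exactly; each group is then merged into one family. -/
lemma IsAmplifiedEssential.double [CompleteSpace H] (hT : ∀ j, IsSelfAdjoint (T j))
    {ι : Type*} [DecidableEq ι] [Finite ι]
    (h : IsAmplifiedEssential ι T B) : IsAmplifiedEssential (Bool × ι) T B := by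
  intro V hV ε hε
  obtain ⟨y, hy, hyV, hyo⟩ := exists_decoupled_families hT
    (P := fun y : ι × Fin q → H => Orthonormal ℂ y ∧ ∃ B' : Fin m → Fin q → Fin q → ℂ,
      (∀ j a b, ‖B' j a b - B j a b‖ < ε) ∧
      ∀ j a b, ⟪y a, T j (y b)⟫_ℂ = if a.1 = b.1 then B' j a.2 b.2 else 0)
    (fun V hV => by
      obtain ⟨x, hx, hxV, hB⟩ := h V hV ε hε
      exact ⟨x, ⟨hx, hB⟩, hxV⟩)
    -- Radon's theorem needs strictly more than dimension plus one points.
    (Module.finrank ℝ (Fin m → Fin q → Fin q → ℂ) + 2) V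
  choose hyn C hCB hC using hy
  obtain ⟨t, ht0, ht1, htd, htC⟩ := exists_radon_weights (by omega) C
  have htd' : ∀ s s' i, s ≠ s' → √(t s i) * √(t s' i) = 0 := by
    intro s s' i hs
    rw [← Real.sqrt_mul (ht0 s i)]
    cases s <;> cases s' <;> simp_all [mul_comm]
  have hts : ∀ s i, √(t s i) * √(t s i) = t s i := fun s i => Real.mul_self_sqrt (ht0 s i)
  have htC' : ∀ s, ∑ i, t s i • C i = ∑ i, t true i • C i := by
    intro s; cases s <;> simp [htC]
  have htCe : ∀ s j a b, ∑ i, (t s i : ℂ) * C i j a b = (∑ i, t true i • C i) j a b := by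
    intro s j a b
    rw [← htC' s]
    simp [Finset.sum_apply]
  -- Square roots make diagonal entries convex combinations with weights `t`; disjoint supports make
  -- the two copies orthogonal and decoupled.
  refine ⟨fun a => ∑ i, ((√(t a.1.1 i) : ℝ) : ℂ) • y i (a.1.2, a.2), ?_, fun a => ?_,
    ∑ i, t true i • C i, fun j a b => ?_, ?_⟩
  · classical
    rw [orthonormal_iff_ite]
    rintro ⟨⟨s, k⟩, a⟩ ⟨⟨s', l⟩, b⟩
    refine (inner_sum_smul_of_decoupled (ContinuousLinearMap.id ℂ H) y
      (fun i k hik a b => (hyo i k hik a b).1) _ _ _ _).trans ?_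
    by_cases hs : s = s'
    · subst hs
      simp only [ContinuousLinearMap.id_apply, hts, orthonormal_iff_ite.1 (hyn _), ← Finset.sum_mul]
      rw [← Complex.ofReal_sum, ht1]
      simp [Prod.mk.injEq]
    · simp [htd' s s' _ hs, hs, -Complex.ofReal_mul]
  · exact Submodule.sum_mem _ fun i _ => Submodule.smul_mem _ _ (hyV i _)
  · rw [← htCe true]
    -- Averaging keeps each entry within ε, balls being convex.
    have := (convex_ball (B j a b) ε).sum_mem (t := Finset.univ) (w := t true)
      (z := fun i => C i j a b) (fun i _ => ht0 true i) (ht1 true)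
      (fun i _ => by rw [mem_ball_iff_norm]; exact hCB i j a b)
    rw [mem_ball_iff_norm] at this
    simpa using this
  · rintro j ⟨⟨s, k⟩, a⟩ ⟨⟨s', l⟩, b⟩
    refine (inner_sum_smul_of_decoupled (T j) y
      (fun i k hik a b => (hyo i k hik a b).2 j) _ _ _ _).trans ?_
    by_cases hs : s = s'
    · subst hs
      simp only [hts, hC]
      by_cases hkl : k = l
      · simp [hkl, ← htCe s]
      · simp [hkl]
    · simp [htd' s s' _ hs, hs, -Complex.ofReal_mul]

lemma IsEssential.isAmplifiedEssential [CompleteSpace H] (hT : ∀ j, IsSelfAdjoint (T j))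
    (h : IsEssential T B) (p : ℕ) : IsAmplifiedEssential (Fin (p + 1)) T B := by
  induction p with
  | zero =>
    exact h.isAmplifiedEssential_unit.comap
      ⟨fun _ => (), fun _ _ _ => Subsingleton.elim (α := Fin 1) _ _⟩
  | succ p ih =>
    -- Since `p + 2 ≤ 2 * (p + 1)`, one index of the second copy suffices.
    refine (ih.double hT).comap
      ⟨Fin.lastCases (false, 0) (fun k => (true, k)), fun i k hik => ?_⟩
    induction i using Fin.lastCases <;> induction k using Fin.lastCases <;> simp_all

/-- The complement of the kernel of a finite-rank operator is finite-dimensional. -/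
lemma FiniteRank.exists_orthogonal_le_ker [CompleteSpace H] {F : H →L[ℂ] H} (hF : FiniteRank F) :
    ∃ V : Submodule ℂ H, FiniteDimensional ℂ V ∧ ∀ x ∈ Vᗮ, F x = 0 := by
  have : FiniteDimensional ℂ (LinearMap.range F.toLinearMap) := hF
  -- If `x` is orthogonal to `F* F x`, then `‖F x‖² = 0`.
  refine ⟨(LinearMap.range F.toLinearMap).map (ContinuousLinearMap.adjoint F).toLinearMap,
    inferInstance, fun x hx => ?_⟩
  rw [← inner_self_eq_zero (𝕜 := ℂ), ← ContinuousLinearMap.adjoint_inner_left]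
  exact (Submodule.mem_orthogonal _ _).1 hx _ ⟨F x, ⟨x, rfl⟩, rfl⟩

lemma exists_orthogonal_le_ker [CompleteSpace H] {F : Fin m → H →L[ℂ] H}
    (hF : ∀ j, FiniteRank (F j)) :
    ∃ V : Submodule ℂ H, FiniteDimensional ℂ V ∧ ∀ j, ∀ x ∈ Vᗮ, F j x = 0 := by
  choose V hV hVF using fun j => (hF j).exists_orthogonal_le_ker
  exact ⟨⨆ j, V j, inferInstance, fun j x hx =>
    hVF j x (Submodule.orthogonal_le (le_iSup V j) hx)⟩

/-- Compressing to a subspace of `Vᗮ`, on which every `F j` vanishes, does not see the perturbation.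
-/
lemma IsEssential.mem_closure_jointRange [CompleteSpace H] (hT : ∀ j, IsSelfAdjoint (T j))
    (h : IsEssential T B) {p : ℕ} (hp : 1 ≤ p) {F : Fin m → H →L[ℂ] H}
    (hF : ∀ j, FiniteRank (F j)) : B ∈ closure (jointRange p q (T + F)) := by
  obtain ⟨p, rfl⟩ := Nat.exists_eq_add_of_le' hp
  obtain ⟨V, hV, hVF⟩ := exists_orthogonal_le_ker hF
  rw [mem_closure_iff_entries]
  intro ε hε
  obtain ⟨x, hx, hxV, B', hB', hxB⟩ := h.isAmplifiedEssential hT p V hV ε hε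
  refine ⟨B', (mem_jointRange_iff _ _).2 ⟨x, hx, fun j a b => ?_⟩, hB'⟩
  simp [hVF j _ (hxV b), hxB]

lemma IsEssential.add_finiteRank [CompleteSpace H] (h : IsEssential T B) {F : Fin m → H →L[ℂ] H}
    (hF : ∀ j, FiniteRank (F j)) : IsEssential (T + F) B := by
  obtain ⟨V, hV, hVF⟩ := exists_orthogonal_le_ker hF
  intro U hU ε hε
  obtain ⟨x, hx, hxV, hxB⟩ := h (U ⊔ V) inferInstance ε hε
  refine ⟨x, hx, fun a => Submodule.orthogonal_le le_sup_left (hxV a), fun j a b => ?_⟩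
  simpa [hVF j _ (Submodule.orthogonal_le le_sup_right (hxV b))] using hxB j a b

lemma IsEssential.of_conj [CompleteSpace H] {K : Submodule ℂ H} {Y : Kᗮ →L[ℂ] H} (hY : IsIsom Y)
    (h : IsEssential (fun j => conj Y (T j)) B) : IsEssential T B := by
  intro V hV ε hε
  obtain ⟨x, hx, hxV, hxB⟩ :=
    h (V.map (ContinuousLinearMap.adjoint Y).toLinearMap) inferInstance ε hε
  have hin : ∀ u v, ⟪Y u, Y v⟫_ℂ = ⟪u, v⟫_ℂ := fun u v => by
    rw [← ContinuousLinearMap.adjoint_inner_right]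
    exact congrArg _ (DFunLike.congr_fun hY v)
  refine ⟨fun a => Y (x a), ?_, fun a => ?_, fun j a b => ?_⟩
  · classical
    rw [orthonormal_iff_ite] at hx ⊢
    simpa only [hin] using hx
  · rw [Submodule.mem_orthogonal]
    intro u hu
    rw [← ContinuousLinearMap.adjoint_inner_left]
    exact (Submodule.mem_orthogonal _ _).1 (hxV a) _ ⟨u, hu, rfl⟩
  · simpa [conj, ContinuousLinearMap.adjoint_inner_right] using hxB j a b

lemma IsEssential.conj [CompleteSpace H] {K : Submodule ℂ H} {Y : Kᗮ →L[ℂ] H}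
    (hY : IsCofiniteIsom K Y) (h : IsEssential T B) :
    IsEssential (fun j => conj Y (T j)) B := by
  obtain ⟨-, hYi, hYr⟩ := hY
  intro V hV ε hε
  -- Orthogonality to the finite-dimensional complement of the range forces the vectors into the
  -- range, which is closed, so they lift through `Y`.
  obtain ⟨x, hx, hxV, hxB⟩ :=
    h (V.map Y.toLinearMap ⊔ (LinearMap.range Y.toLinearMap)ᗮ) inferInstance ε hε
  have hin : ∀ u v, ⟪Y u, Y v⟫_ℂ = ⟪u, v⟫_ℂ := fun u v => by
    rw [← ContinuousLinearMap.adjoint_inner_right]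
    exact congrArg _ (DFunLike.congr_fun hYi v)
  let Yi : Kᗮ →ₗᵢ[ℂ] H := ⟨Y.toLinearMap, fun v => by
    rw [@norm_eq_sqrt_re_inner ℂ, @norm_eq_sqrt_re_inner ℂ]
    exact congrArg (fun z => Real.sqrt (RCLike.re z)) (hin v v)⟩
  have hclosed : IsClosed ((LinearMap.range Y.toLinearMap : Submodule ℂ H) : Set H) := by
    have := Yi.isometry.isClosedEmbedding.isClosed_range
    simpa [LinearMap.coe_range, Yi] using this
  have : CompleteSpace (LinearMap.range Y.toLinearMap) := hclosed.completeSpace_coe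
  have hrange : ∀ a, ∃ v, Y v = x a := fun a => by
    have h := Submodule.orthogonal_le le_sup_right (hxV a)
    rw [Submodule.orthogonal_orthogonal] at h
    exact h
  choose v hv using hrange
  refine ⟨v, ?_, fun a => ?_, fun j a b => ?_⟩
  · classical
    rw [orthonormal_iff_ite] at hx ⊢
    simpa only [← hin, hv] using hx
  · rw [Submodule.mem_orthogonal]
    intro u hu
    rw [← hin, hv]
    exact (Submodule.mem_orthogonal _ _).1 (Submodule.orthogonal_le le_sup_left (hxV a)) _
      (Submodule.mem_map_of_mem (f := Y.toLinearMap) hu)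
  · simpa [MatricialRange.conj, ContinuousLinearMap.adjoint_inner_right, hv] using hxB j a b

end

/-! ### From perturbed compressions back to essential tuples. -/

section

variable {H : Type*} [NormedAddCommGroup H] [InnerProductSpace ℂ H]

lemma exists_unit_mem_orthogonal (hH : ¬ FiniteDimensional ℂ H) (V : Submodule ℂ H)
    [FiniteDimensional ℂ V] : ∃ u ∈ Vᗮ, ‖u‖ = 1 := by
  have hne : Vᗮ ≠ ⊥ := fun h => hH <| by
    rw [Submodule.orthogonal_eq_bot_iff] at h
    subst h
    exact Module.Finite.equiv (Submodule.topEquiv (R := ℂ) (M := H))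
  obtain ⟨u, hu, hu0⟩ := Submodule.exists_mem_ne_zero_of_ne_bot hne
  exact ⟨((‖u‖⁻¹ : ℝ) : ℂ) • u, Submodule.smul_mem _ _ hu, by simp [norm_smul, hu0]⟩

/-- The joint essential numerical range of self-adjoint operators is nonempty. -/
lemma exists_essential_numerical_value [CompleteSpace H] (hH : ¬ FiniteDimensional ℂ H) {m : ℕ}
    {T : Fin m → H →L[ℂ] H} (hT : ∀ j, IsSelfAdjoint (T j)) :
    ∃ c : Fin m → ℝ, ∀ V : Submodule ℂ H, FiniteDimensional ℂ V → ∀ ε > 0,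
      ∃ u ∈ Vᗮ, ‖u‖ = 1 ∧ ∀ j, ‖⟪u, T j u⟫_ℂ - c j‖ < ε := by
  let S : Submodule ℂ H → Set (Fin m → ℝ) := fun V =>
    {w | ∃ u ∈ Vᗮ, ‖u‖ = 1 ∧ ∀ j, ⟪u, T j u⟫_ℂ = w j}
  have hanti : ∀ {V U : Submodule ℂ H}, V ≤ U → S U ⊆ S V := by
    rintro V U hVU w ⟨u, hu, h⟩
    exact ⟨u, Submodule.orthogonal_le hVU hu, h⟩
  have hbdd : ∀ V, closure (S V) ⊆ Set.univ.pi fun j => Set.Icc (-‖T j‖) ‖T j‖ := by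
    intro V
    refine closure_minimal ?_ (isCompact_univ_pi fun j => isCompact_Icc).isClosed
    rintro w ⟨u, hu, hu1, hw⟩ j -
    refine abs_le.1 ?_
    calc |w j| = ‖⟪u, T j u⟫_ℂ‖ := by rw [hw]; simp
      _ ≤ ‖u‖ * ‖T j u‖ := norm_inner_le_norm _ _
      _ ≤ ‖T j‖ := by rw [hu1, one_mul]; simpa [hu1] using (T j).le_opNorm u
  have hcpt : ∀ V, IsCompact (closure (S V)) := fun V =>
    (isCompact_univ_pi fun j => isCompact_Icc).of_isClosed_subset isClosed_closure (hbdd V)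
  let ι := {V : Submodule ℂ H // FiniteDimensional ℂ V}
  have : Nonempty ι := ⟨⟨⊥, inferInstance⟩⟩
  -- The closed sets of values on `Vᗮ` are compact and directed under enlarging `V`, so they share a
  -- point.
  obtain ⟨c, hc⟩ := IsCompact.nonempty_iInter_of_directed_nonempty_isCompact_isClosed
    (fun V : ι => closure (S V.1)) (fun V U => by
      have := V.2
      have := U.2
      exact ⟨⟨V.1 ⊔ U.1, inferInstance⟩, closure_mono (hanti le_sup_left),
        closure_mono (hanti le_sup_right)⟩)
    (fun V => by
      have := V.2
      obtain ⟨u, hu, hu1⟩ := exists_unit_mem_orthogonal hH V.1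
      refine Set.Nonempty.closure ⟨fun j => (⟪u, T j u⟫_ℂ).re, u, hu, hu1, fun j => ?_⟩
      refine (Complex.conj_eq_iff_re.1 ?_).symm
      rw [inner_conj_symm, ← ContinuousLinearMap.adjoint_inner_right, (hT j).adjoint_eq])
    (fun V => hcpt V.1) (fun V => isClosed_closure)
  refine ⟨c, fun V hV ε hε => ?_⟩
  obtain ⟨w, ⟨u, hu, hu1, hw⟩, hcw⟩ :=
    Metric.mem_closure_iff.1 (Set.mem_iInter.1 hc ⟨V, hV⟩) ε hε
  refine ⟨u, hu, hu1, fun j => ?_⟩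
  rw [dist_comm, dist_pi_lt_iff hε] at hcw
  rw [hw, ← Complex.ofReal_sub, Complex.norm_real, ← dist_eq_norm]
  exact hcw j

/-- The finite-rank perturbation turning `T` into `(1 - P) T (1 - P) + c P`, with `P` the
orthogonal projection onto `V`. -/
noncomputable def decouplingPerturbation (T : H →L[ℂ] H) (c : ℝ) (V : Submodule ℂ H)
    [V.HasOrthogonalProjection] : H →L[ℂ] H :=
  V.starProjection * T * V.starProjection - V.starProjection * T - T * V.starProjection +
    (c : ℂ) • V.starProjection

lemma decouplingPerturbation_isSelfAdjoint [CompleteSpace H] {T : H →L[ℂ] H} (hT : IsSelfAdjoint T)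
    (c : ℝ) (V : Submodule ℂ H) [V.HasOrthogonalProjection] :
    IsSelfAdjoint (decouplingPerturbation T c V) := by
  have hP : star V.starProjection = V.starProjection := isSelfAdjoint_starProjection V
  rw [isSelfAdjoint_iff, decouplingPerturbation]
  simp only [star_add, star_sub, star_mul, star_smul, hP, hT.star_eq, mul_assoc]
  simp only [RCLike.star_def, Complex.conj_ofReal]
  abel

lemma decouplingPerturbation_finiteRank (T : H →L[ℂ] H) (c : ℝ) (V : Submodule ℂ H)
    [FiniteDimensional ℂ V] : FiniteRank (decouplingPerturbation T c V) := by
  refine Submodule.finiteDimensional_of_le (S₂ := V ⊔ V.map T.toLinearMap) ?_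
  rintro _ ⟨x, rfl⟩
  have hm : ∀ y, V.starProjection y ∈ V := Submodule.starProjection_apply_mem V
  refine Submodule.add_mem _ (Submodule.sub_mem _ (Submodule.sub_mem _ ?_ ?_) ?_) ?_
  · exact Submodule.mem_sup_left (hm _)
  · exact Submodule.mem_sup_left (hm _)
  · exact Submodule.mem_sup_right (Submodule.mem_map_of_mem (f := T.toLinearMap) (hm x))
  · exact Submodule.mem_sup_left (Submodule.smul_mem _ _ (hm x))

lemma inner_add_decouplingPerturbation [CompleteSpace H] (T : H →L[ℂ] H) (c : ℝ) (V : Submodule ℂ H)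
    [V.HasOrthogonalProjection] (x y : H) :
    ⟪x, (T + decouplingPerturbation T c V) y⟫_ℂ =
      ⟪x - V.starProjection x, T (y - V.starProjection y)⟫_ℂ +
        c * ⟪V.starProjection x, V.starProjection y⟫_ℂ := by
  have hP : ∀ u v, ⟪V.starProjection u, v⟫_ℂ = ⟪u, V.starProjection v⟫_ℂ :=
    Submodule.inner_starProjection_left_eq_right V
  have hPP : ∀ u, V.starProjection (V.starProjection u) = V.starProjection u := fun u =>
    Submodule.starProjection_eq_self_iff.2 (Submodule.starProjection_apply_mem V u)
  simp only [decouplingPerturbation, add_apply, sub_apply,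
    ContinuousLinearMap.mul_def, ContinuousLinearMap.comp_apply, smul_apply, inner_sub_left, hP, map_sub,
    hPP, inner_add_right, inner_sub_right, inner_smul_right]
  ring

/-- In a compression of the perturbed tuple, the components `P (x a)` contribute only `c` times
their Gram matrix. Replacing them by vectors with that Gram matrix, orthogonal to `V` and decoupled
from the rest, nearly reproduces this contribution under `T`. -/
lemma isEssential_of_forall_mem_closure_W [CompleteSpace H] (hH : ¬ FiniteDimensional ℂ H)
    {m q : ℕ} {T : Fin m → H →L[ℂ] H} (hT : ∀ j, IsSelfAdjoint (T j))
    {B : Fin m → Matrix (Fin q) (Fin q) ℂ}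
    (hB : ∀ F ∈ saFiniteRank m H, B ∈ closure (W q (T + F))) : IsEssential T B := by
  intro V hV ε hε
  obtain ⟨c, hc⟩ := exists_essential_numerical_value hH hT
  obtain ⟨B', hB', hBB'⟩ := (mem_closure_iff_entries _ _).1
    (hB (fun j => decouplingPerturbation (T j) (c j) V) fun j =>
      ⟨decouplingPerturbation_isSelfAdjoint (hT j) _ V, decouplingPerturbation_finiteRank _ _ V⟩)
    (ε / 2) (half_pos hε)
  obtain ⟨x, hx, hxB⟩ := (mem_W_iff _ _).1 hB'
  set P := V.starProjection
  have hPm : ∀ u, P u ∈ V := Submodule.starProjection_apply_mem V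
  have hxB' : ∀ j a b, ⟪x a - P (x a), T j (x b - P (x b))⟫_ℂ + c j * ⟪P (x a), P (x b)⟫_ℂ =
      B' j a b := fun j a b => by
    rw [← hxB, Pi.add_apply, inner_add_decouplingPerturbation]
  set y : Fin q → H := fun a => x a - P (x a) with hy
  have hyV : ∀ a, y a ∈ Vᗮ := fun a => Submodule.sub_starProjection_mem_orthogonal _
  let S : Set H := Set.range y ∪ Set.range fun ja : Fin m × Fin q => T ja.1 (y ja.2)
  have hS : S.Finite := (Set.finite_range _).union (Set.finite_range _)
  have : FiniteDimensional ℂ (Submodule.span ℂ S) := FiniteDimensional.span_of_finite ℂ hS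
  set r := Module.finrank ℂ V
  -- The `r` new vectors together cost at most `ε / 2`; `r + 1` also covers `V = 0`.
  have hδ : 0 < ε / 2 / (r + 1) := by positivity
  obtain ⟨u, hu, huV, huo⟩ := exists_decoupled_families hT
    (P := fun u : Unit → H => ‖u ()‖ = 1 ∧ ∀ j, ‖⟪u (), T j (u ())⟫_ℂ - c j‖ < ε / 2 / (r + 1))
    (fun U hU => by
      obtain ⟨u, hu, hu1, huc⟩ := hc U hU _ hδ
      exact ⟨fun _ => u, ⟨hu1, huc⟩, fun _ => hu⟩)
    r (V ⊔ Submodule.span ℂ S)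
  have hyu : ∀ a i, ⟪y a, u i ()⟫_ℂ = 0 := fun a i =>
    (Submodule.mem_orthogonal _ _).1 (huV i ()) _
      (Submodule.mem_sup_right (Submodule.subset_span (Or.inl ⟨a, rfl⟩)))
  have hTyu : ∀ j a i, ⟪T j (y a), u i ()⟫_ℂ = 0 := fun j a i =>
    (Submodule.mem_orthogonal _ _).1 (huV i ()) _
      (Submodule.mem_sup_right (Submodule.subset_span (Or.inr ⟨(j, a), rfl⟩)))
  have hyTu : ∀ j a i, ⟪y a, T j (u i ())⟫_ℂ = 0 := fun j a i => by
    rw [← hTyu j a i, ← ContinuousLinearMap.adjoint_inner_left, (hT j).adjoint_eq]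
  let e := stdOrthonormalBasis ℂ V
  -- Coordinates of `P (x a)`; sending `e i` to `u i` is isometric, so Gram matrices are kept.
  let z : Fin q → Fin r → ℂ := fun a i => ⟪(e i : H), P (x a)⟫_ℂ
  have hz : ∀ a b, ∑ i, (starRingEnd ℂ) (z a i) * z b i = ⟪P (x a), P (x b)⟫_ℂ := fun a b => by
    have := e.sum_inner_mul_inner ⟨P (x a), hPm _⟩ ⟨P (x b), hPm _⟩
    simpa [z, Submodule.coe_inner] using this
  have hz1 : ∀ a i, ‖z a i‖ ≤ 1 := fun a i => by
    calc ‖z a i‖ ≤ ‖(e i : H)‖ * ‖P (x a)‖ := norm_inner_le_norm _ _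
      _ = ‖P (x a)‖ := by
        have : ‖(e i : H)‖ = 1 := e.orthonormal.1 i
        rw [this, one_mul]
      _ ≤ ‖x a‖ := V.norm_starProjection_apply_le _
      _ = 1 := hx.1 a
  -- Applied to the identity for orthonormality and to `T j` for the entries.
  have key : ∀ L : H →L[ℂ] H, (∀ a i, ⟪y a, L (u i ())⟫_ℂ = 0) →
      (∀ a i, ⟪u i (), L (y a)⟫_ℂ = 0) →
      (∀ i k, i ≠ k → ⟪u i (), L (u k ())⟫_ℂ = 0) → ∀ a b,
      ⟪y a + ∑ i, z a i • u i (), L (y b + ∑ i, z b i • u i ())⟫_ℂ = ⟪y a, L (y b)⟫_ℂ +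
        ∑ i, (starRingEnd ℂ) (z a i) * z b i * ⟪u i (), L (u i ())⟫_ℂ := by
    intro L h1 h2 h3 a b
    simp only [map_add, map_sum, map_smul, inner_add_left, inner_add_right, sum_inner, inner_sum,
      inner_smul_left, inner_smul_right, h1, h2, mul_zero, Finset.sum_const_zero, add_zero,
      zero_add]
    congr 1
    refine Finset.sum_congr rfl fun i _ => ?_
    rw [Finset.sum_eq_single i]
    · ring
    · intro k _ hk
      simp [h3 k i hk]
    · simp
  refine ⟨fun a => y a + ∑ i, z a i • u i (), ?_, fun a => ?_, fun j a b => ?_⟩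
  · rw [orthonormal_iff_ite] at hx ⊢
    intro a b
    refine (key (ContinuousLinearMap.id ℂ H) hyu
      (fun a i => inner_eq_zero_symm.1 (hyu a i)) (fun i k hik => (huo i k hik () ()).1) a b).trans ?_
    have huu : ∀ i, ⟪u i (), u i ()⟫_ℂ = 1 := fun i => by
      rw [inner_self_eq_norm_sq_to_K, (hu i).1]
      simp
    simp only [ContinuousLinearMap.id_apply, huu, mul_one]
    rw [← hx a b]
    have h1 : ⟪y a, P (x b)⟫_ℂ = 0 :=
      inner_eq_zero_symm.1 ((Submodule.mem_orthogonal _ _).1 (hyV a) _ (hPm _))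
    have h2 : ⟪P (x a), y b⟫_ℂ = 0 := (Submodule.mem_orthogonal _ _).1 (hyV b) _ (hPm _)
    have h3 : ∀ a, x a = y a + P (x a) := fun a => (sub_add_cancel _ _).symm
    conv_rhs => rw [h3 a, h3 b, inner_add_left, inner_add_right, inner_add_right, h1, h2, ← hz]
    simp
  · exact Submodule.add_mem _ (hyV a) (Submodule.sum_mem _ fun i _ =>
      Submodule.smul_mem _ _ (Submodule.orthogonal_le le_sup_left (huV i ())))
  · rw [key (T j) (hyTu j) (fun a i => inner_eq_zero_symm.1 (hTyu j a i))
      (fun i k hik => (huo i k hik () ()).2 j)]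
    have hdiff : ⟪y a, T j (y b)⟫_ℂ +
        ∑ i, (starRingEnd ℂ) (z a i) * z b i * ⟪u i (), T j (u i ())⟫_ℂ - B j a b =
        ∑ i, (starRingEnd ℂ) (z a i) * z b i * (⟪u i (), T j (u i ())⟫_ℂ - c j) +
          (B' j a b - B j a b) := by
      rw [← hxB' j a b, ← hz, Finset.mul_sum]
      simp only [mul_sub, Finset.sum_sub_distrib]
      simp only [mul_comm (c j : ℂ)]
      ring
    rw [hdiff]
    have hsum : ‖∑ i, (starRingEnd ℂ) (z a i) * z b i * (⟪u i (), T j (u i ())⟫_ℂ - c j)‖ ≤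
        r * (ε / 2 / (r + 1)) := by
      refine (norm_sum_le _ _).trans
        ((Finset.sum_le_card_nsmul _ _ (ε / 2 / (r + 1)) fun i _ => ?_).trans_eq ?_)
      swap
      · rw [Finset.card_univ, Fintype.card_fin, nsmul_eq_mul]
      rw [norm_mul, norm_mul, RCLike.norm_conj]
      calc _ ≤ 1 * 1 * (ε / 2 / (r + 1)) := by
            gcongr
            · exact hz1 a i
            · exact hz1 b i
            · exact ((hu i).2 j).le
        _ = _ := by ring
    have hr2 : r * (ε / 2 / (r + 1)) ≤ ε / 2 := by
      rw [mul_div_assoc', div_le_iff₀ (by positivity)]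
      nlinarith
    calc _ ≤ _ := norm_add_le _ _
      _ < ε / 2 + ε / 2 := add_lt_add_of_le_of_lt (hsum.trans hr2) (hBB' j a b)
      _ = ε := add_halves ε

lemma FiniteRank.neg {F : H →L[ℂ] H} (hF : FiniteRank F) : FiniteRank (-F) := by
  have : FiniteDimensional ℂ (LinearMap.range F.toLinearMap) := hF
  refine Submodule.finiteDimensional_of_le (S₂ := LinearMap.range F.toLinearMap) ?_
  rintro _ ⟨x, rfl⟩
  exact Submodule.neg_mem _ ⟨x, rfl⟩

variable [CompleteSpace H] {m p q : ℕ} {T : Fin m → H →L[ℂ] H}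

/-- All descriptions of the essential ranges of a self-adjoint tuple coincide. -/
lemma essential_ranges_eq (hH : ¬ FiniteDimensional ℂ H) (hp : 1 ≤ p)
    (hT : ∀ j, IsSelfAdjoint (T j)) :
    essRange p q T = {B | IsEssential T B} ∧ Wess q T = {B | IsEssential T B} ∧
      (⋂ F ∈ saFiniteRank m H, closure (jointRange p q (T + F))) = {B | IsEssential T B} ∧
      (⋂ F ∈ saFiniteRank m H, closure (W q (T + F))) = {B | IsEssential T B} := by
  have hJW : ∀ F : Fin m → H →L[ℂ] H,
      closure (jointRange p q (T + F)) ⊆ closure (W q (T + F)) := fun F =>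
    closure_mono (jointRange_subset_W hp _)
  have hJ : ∀ {B : Fin m → Matrix (Fin q) (Fin q) ℂ}, IsEssential T B →
      ∀ F : Fin m → H →L[ℂ] H, (∀ j, FiniteRank (F j)) →
        B ∈ closure (jointRange p q (T + F)) := fun h F hF =>
    h.mem_closure_jointRange hT hp hF
  -- Every set lies between the intersection of `jointRange` closures over all finite-rank `F` and
  -- that of `W` closures over self-adjoint `F`.
  refine ⟨?_, ?_, ?_, ?_⟩ <;> ext B <;>
    simp only [essRange, Wess, Set.mem_iInter, Set.mem_ofPred_eq] <;>
    refine ⟨fun h => isEssential_of_forall_mem_closure_W hH hT fun F hF => ?_, fun h F hF => ?_⟩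
  · exact hJW F (h F fun j => (hF j).2)
  · exact hJ h F hF
  · exact h F fun j => (hF j).2
  · exact hJW F (hJ h F hF)
  · exact hJW F (h F hF)
  · exact hJ h F fun j => (hF j).2
  · exact h F hF
  · exact hJW F (hJ h F fun j => (hF j).2)

lemma setOf_isEssential_conj {K : Submodule ℂ H} {Y : Kᗮ →L[ℂ] H} (hY : IsCofiniteIsom K Y) :
    {B : Fin m → Matrix (Fin q) (Fin q) ℂ | IsEssential (fun j => conj Y (T j)) B} =
      {B | IsEssential T B} :=
  Set.ext fun _ => ⟨fun h => h.of_conj hY.2.1, fun h => h.conj hY⟩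

lemma setOf_isEssential_add {F : Fin m → H →L[ℂ] H} (hF : ∀ j, FiniteRank (F j)) :
    {B : Fin m → Matrix (Fin q) (Fin q) ℂ | IsEssential (T + F) B} = {B | IsEssential T B} :=
  Set.ext fun B => ⟨fun h => by
    have h' := IsEssential.add_finiteRank (F := -F) h fun j => (hF j).neg
    rwa [add_neg_cancel_right] at h', fun h => h.add_finiteRank hF⟩

end

end MatricialRange

theorem corollary4p4 {H : Type*}
    [NormedAddCommGroup H] [InnerProductSpace ℂ H] [CompleteSpace H]
    (hH : ¬ FiniteDimensional ℂ H)
    {m : ℕ} (p q : ℕ) (hp : 1 ≤ p) (hq : 1 ≤ q)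
    (A : Fin m → H →L[ℂ] H) (hA : ∀ j, IsSelfAdjoint (A j))
    (F₀ : Fin m → H →L[ℂ] H) (hF₀ : F₀ ∈ MatricialRange.saFiniteRank m H)
    (K : Submodule ℂ H) (Y₀ : Kᗮ →L[ℂ] H) (hY₀ : MatricialRange.IsCofiniteIsom K Y₀) :
    (MatricialRange.essRange p q A
        = MatricialRange.essRange p q (fun j => MatricialRange.conj Y₀ (A j)) ∧
      MatricialRange.essRange p q A = MatricialRange.essRange p q (A + F₀) ∧
      MatricialRange.essRange p q A
        = ⋂ F ∈ MatricialRange.saFiniteRank m H,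
            closure (MatricialRange.jointRange p q (A + F))) ∧
    MatricialRange.essRange p q A = MatricialRange.Wess q A ∧
    (MatricialRange.Wess q A
        = MatricialRange.Wess q (fun j => MatricialRange.conj Y₀ (A j)) ∧
      MatricialRange.Wess q A = MatricialRange.Wess q (A + F₀) ∧
      MatricialRange.Wess q A
        = ⋂ F ∈ MatricialRange.saFiniteRank m H, closure (MatricialRange.W q (A + F))) := by
  -- Otherwise `K ⊔ Kᗮ`, which is all of `H`, would be finite-dimensional.
  have hK : ¬ FiniteDimensional ℂ Kᗮ := fun h => by
    have := hY₀.1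
    obtain ⟨u, hu, hu1⟩ := MatricialRange.exists_unit_mem_orthogonal hH (K ⊔ Kᗮ)
    rw [Submodule.sup_orthogonal_of_hasOrthogonalProjection, Submodule.top_orthogonal_eq_bot,
      Submodule.mem_bot] at hu
    simp [hu] at hu1
  have hAY : ∀ j, IsSelfAdjoint (MatricialRange.conj Y₀ (A j)) := fun j =>
    (hA j).adjoint_conj Y₀
  obtain ⟨h1, h2, h3, h4⟩ := MatricialRange.essential_ranges_eq (q := q) hH hp hA
  obtain ⟨h5, h6, -, -⟩ := MatricialRange.essential_ranges_eq (q := q) hK hp hAY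
  obtain ⟨h7, h8, -, -⟩ := MatricialRange.essential_ranges_eq (q := q) hH hp
    (T := A + F₀) fun j => (hA j).add (hF₀ j).1
  rw [h1, h2, h3, h4, h5, h6, h7, h8, MatricialRange.setOf_isEssential_conj hY₀,
    MatricialRange.setOf_isEssential_add fun j => (hF₀ j).2]
  simp
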